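/- Let $\Sigma$ be a non-empty finite alphabet, let $I\subset\Sigma\times\Sigma$ be an irreflexive and symmetric (independence) relation, and let $\mathcal{M}=\langle\Sigma\mid \alpha\cdot\beta=\beta\cdot\alpha \text{ for } (\alpha,\beta)\in I\rangle$ be the associated trace monoid, with unit element $0$ (the empty trace), length $|\cdot|$ (the number of letters of a representative word) and left divisibility order $u\leq v\iff\exists w\in\mathcal{M},\ v=u\cdot w$. Assume that $\mathcal{M}$ is irreducible: the graph on $\Sigma$ with edge relation $(\Sigma\times\Sigma)\setminus I$ is connected. A *clique* is a product $\alpha_1\cdots\alpha_n$ ($n\geq 0$) of letters with $(\alpha_i,\alpha_j)\in I$ for all $i\neq j$; let $\mathscr{C}$ be the finite set of cliques. A *valuation* is a function $f:\mathcal{M}\to(0,\infty)$ with $f(u\cdot v)=f(u)f(v)$ for all $u,v\in\mathcal{M}$; its *Möbius transform* is $$h(c)=\sum_{c'\in\mathscr{C},\ c\leq c'}(-1)^{|c'|-|c|}f(c'),\qquad c\in\mathscr{C},$$ and $f$ is a *Möbius valuation* if $h(0)=0$ and $h(c)>0$ for every clique $c\neq 0$. Let $\mathcal{W}$ be the partially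 ordered set obtained from the non-decreasing sequences $(u_k)_{k\geq0}$ in $(\mathcal{M},\leq)$, preordered by $(u_k)\preccurlyeq(u'_k)\iff\forall k\ \exists k'\ u_k\leq u'_{k'}$, by identifying equivalent sequences; $\mathcal{M}$ embeds in $\mathcal{W}$ through constant sequences. The *boundary* is $\partial\mathcal{M}=\mathcal{W}\setminus\mathcal{M}$, with the $\sigma$-algebra generated by the sets $\uparrow u=\{\xi\in\partial\mathcal{M}: u\leq\xi\}$, $u\in\mathcal{M}$. A *Bernoulli measure* is a probability measure $\mathbb{P}$ on $\partial\mathcal{M}$ such that $\mathbb{P}(\uparrow u)>0$ and $\mathbb{P}(\uparrow(u\cdot v))=\mathbb{P}(\uparrow u)\,\mathbb{P}(\uparrow v)$ for all $u,v\in\mathcal{M}$. Then: 1. For every Bernoulli measure $\mathbb{P}$ on $\partial\mathcal{M}$, the function $u\mapsto\mathbb{P}(\uparrow u)$ is a Möbius valuation. 2. For every Möbius valuation $f:\mathcal{M}\to(0,\infty)$, there exists a unique Bernoulli measure $\mathbb{P}$ on $\partial\mathcal{M}$ such that $\mathbb{P}(\uparrow u)=f(u)$ for all $u\in\mathcal{M}$.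 -/

import Mathlib

/-! Trace monoids, their boundary, Bernoulli measures and Möbius valuations.

An independence pair `(A, I)` is given by a simple graph `G` on the alphabet `A`:
`G.Adj` is the irreflexive and symmetric independence relation `I`. -/

/-- The defining relations `a · b = b · a`, for `(a, b)` independent. -/
inductive TraceRel {A : Type*} (G : SimpleGraph A) : FreeMonoid A → FreeMonoid A → Prop
  | swap (a b : A) (h : G.Adj a b) :
      TraceRel G (FreeMonoid.of a * FreeMonoid.of b) (FreeMonoid.of b * FreeMonoid.of a)

/-- The trace monoid of the independence pair `(A, G.Adj)`. Its unit `1` is the empty trace, and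
Mathlib's divisibility `u ∣ v` on it is left divisibility: `∃ w, v = u * w`. -/
abbrev TraceMonoid {A : Type*} (G : SimpleGraph A) : Type _ := PresentedMonoid (TraceRel G)

namespace TraceMonoid

/-- The dependence graph of `G`: distinct letters that are not independent are adjacent. (The
dependence relation is reflexive as well; loops play no role for connectedness.) -/
def dependenceGraph {A : Type*} (G : SimpleGraph A) : SimpleGraph A := Gᶜ

/-- A trace monoid is irreducible if its dependence graph is connected (in particular, the
alphabet is non-empty). -/
def IsIrreducible {A : Type*} (G : SimpleGraph A) : Prop := (dependenceGraph G).Connected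

/-- The letter `a`, as a trace. -/
def letter {A : Type*} (G : SimpleGraph A) (a : A) : TraceMonoid G :=
  PresentedMonoid.of (TraceRel G) a

/-- The length of traces, as a monoid homomorphism: every letter has length one. -/
def lengthHom {A : Type*} (G : SimpleGraph A) : TraceMonoid G →* Multiplicative ℕ :=
  PresentedMonoid.lift (fun _ : A => Multiplicative.ofAdd 1) (by
    rintro _ _ ⟨a, b, _⟩
    simp)

/-- The length `|u|` of a trace `u`. -/
def length {A : Type*} {G : SimpleGraph A} (u : TraceMonoid G) : ℕ :=
  Multiplicative.toAdd (lengthHom G u)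

/-- A clique is a product of pairwise independent letters. -/
def IsClique {A : Type*} {G : SimpleGraph A} (c : TraceMonoid G) : Prop :=
  ∃ l : List A, l.Pairwise G.Adj ∧ c = (l.map (letter G)).prod

/-- The type of cliques of a trace monoid. -/
abbrev Clique {A : Type*} (G : SimpleGraph A) : Type _ := {c : TraceMonoid G // IsClique c}

instance finite_clique {A : Type*} [Finite A] (G : SimpleGraph A) : Finite (Clique G) := by
  classical
  have := Fintype.ofFinite A
  have hfin : {l : List A | l.Nodup}.Finite := by
    refine (List.finite_length_le A (Fintype.card A)).subset ?_
    intro l hl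
    exact List.Nodup.length_le_card hl
  refine Set.Finite.to_subtype ((hfin.image (fun l => (l.map (letter G)).prod)).subset ?_)
  rintro c ⟨l, hl, rfl⟩
  exact ⟨l, hl.imp (fun h => h.ne), rfl⟩

noncomputable instance fintype_clique {A : Type*} [Finite A] (G : SimpleGraph A) :
    Fintype (Clique G) := Fintype.ofFinite _

/-- The empty clique. -/
def emptyClique {A : Type*} (G : SimpleGraph A) : Clique G := ⟨1, [], List.Pairwise.nil, rfl⟩

open Classical in
/-- The Möbius transform of `f`: `h(c) = ∑ (-1) ^ (|c'| - |c|) f(c')`, over the cliques `c' ≥ c`. -/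
noncomputable def mobiusTransform {A : Type*} [Finite A] {G : SimpleGraph A}
    (f : Clique G → ℝ) (c : Clique G) : ℝ :=
  ∑ c' : Clique G with c.1 ∣ c'.1, (-1 : ℝ) ^ (length c'.1 - length c.1) * f c'

/-- A valuation is a positive multiplicative real function on the trace monoid. -/
structure IsValuation {A : Type*} {G : SimpleGraph A} (f : TraceMonoid G → ℝ) : Prop where
  pos : ∀ u, 0 < f u
  mul : ∀ u v, f (u * v) = f u * f v

/-- A Möbius valuation is a valuation whose Möbius transform vanishes at the empty clique and is
positive at all non-empty cliques. -/
structure IsMobiusValuation {A : Type*} [Finite A] {G : SimpleGraph A}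
    (f : TraceMonoid G → ℝ) : Prop extends IsValuation f where
  mobius_empty : mobiusTransform (fun c : Clique G => f c.1) (emptyClique G) = 0
  mobius_pos : ∀ c : Clique G, c ≠ emptyClique G →
    0 < mobiusTransform (fun c : Clique G => f c.1) c

/-- Non-decreasing sequences of traces, for left divisibility. -/
structure NondecSeq {A : Type*} (G : SimpleGraph A) where
  /-- The underlying sequence. -/
  seq : ℕ → TraceMonoid G
  nondec : ∀ k, seq k ∣ seq (k + 1)

/-- The Egli-Milner preorder on non-decreasing sequences. -/
instance preorder_nondecSeq {A : Type*} (G : SimpleGraph A) : Preorder (NondecSeq G) where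
  le u v := ∀ k, ∃ k', u.seq k ∣ v.seq k'
  le_refl _ k := ⟨k, dvd_refl _⟩
  le_trans _ _ _ huv hvw k :=
    let ⟨k', h⟩ := huv k
    let ⟨k'', h'⟩ := hvw k'
    ⟨k'', h.trans h'⟩

/-- The partially ordered set of generalized traces: the collapse of the preorder on
non-decreasing sequences. -/
abbrev GeneralizedTrace {A : Type*} (G : SimpleGraph A) : Type _ :=
  Antisymmetrization (NondecSeq G) (· ≤ ·)

/-- The embedding of traces into generalized traces, through constant sequences. -/
def toGeneralized {A : Type*} {G : SimpleGraph A} (u : TraceMonoid G) : GeneralizedTrace G :=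
  toAntisymmetrization (· ≤ ·) (⟨fun _ => u, fun _ => dvd_refl u⟩ : NondecSeq G)

/-- The boundary: the set of infinite traces, i.e. of the generalized traces that are not traces. -/
def Boundary {A : Type*} (G : SimpleGraph A) : Type _ :=
  {ξ : GeneralizedTrace G // ξ ∉ Set.range (toGeneralized (G := G))}

/-- The elementary cylinder of base `u`: the infinite traces `ξ` with `u ≤ ξ`. -/
def cylinder {A : Type*} {G : SimpleGraph A} (u : TraceMonoid G) : Set (Boundary G) :=
  {ξ | toGeneralized u ≤ ξ.1}

/-- The σ-algebra on the boundary generated by the elementary cylinders. -/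
instance measurableSpace_boundary {A : Type*} (G : SimpleGraph A) :
    MeasurableSpace (Boundary G) :=
  MeasurableSpace.generateFrom (Set.range (cylinder (G := G)))

/-- A Bernoulli measure is a probability measure on the boundary that is positive and
multiplicative on elementary cylinders. -/
structure IsBernoulli {A : Type*} {G : SimpleGraph A}
    (P : MeasureTheory.Measure (Boundary G)) : Prop where
  isProbabilityMeasure : MeasureTheory.IsProbabilityMeasure P
  pos : ∀ u : TraceMonoid G, 0 < P (cylinder u)
  mul : ∀ u v : TraceMonoid G, P (cylinder (u * v)) = P (cylinder u) * P (cylinder v)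

end TraceMonoid

/-!
Both directions rest on the elementary theory of traces: the monoid is cancellative, two distinct
letters below the same trace are independent (`adj_of_letter_dvd`), a clique lies below a trace as
soon as its letters do (`prodLetters_dvd_iff`), and traces with a common multiple have a least one
(`exists_lcm`). Cliques are handled as finite sets of pairwise independent letters.

*From Bernoulli measures to Möbius valuations.* By inclusion-exclusion, the Möbius transform of
`u ↦ P (cylinder u)` at a clique `c` is the probability that the letters below an infinite trace
are exactly the letters of `c` (`mobiusTransform_measure`). For the empty clique this event is
empty. For a non-empty clique it contains the cylinder of a suitable multiple `v` of `c`, and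
cylinders have positive probability. Irreducibility provides `v` (`exists_pinning_trace`): append
to `c` all the missing letters, each dependent on an earlier one, so that no new letter can be
moved to the front.

*From Möbius valuations to Bernoulli measures.* Let `M n` be the finite, downward closed set of the
traces with at most `n` levels in their heap (equivalently, of the products of `n` cliques). The
Möbius inverse of `f` on `M n`, which is `weight f n`, satisfies `∑ u ∈ M n, x ∣ u, weight f n u =
f x` for `x ∈ M n` (`sum_weight`), because the alternating sum over the cliques dividing a trace on
the right vanishes unless the trace is empty. If `c` is the clique of the letters on level `n` of
`u = v * c`, then `weight f n u = f v * h c` for the Möbius transform `h` (`weight_eq`), so that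
the weights are non-negative, and zero for the traces with fewer than `n` levels since `h 1 = 0`.
Identifying a trace with the set of its divisors gives probability measures on the compact space
`TraceMonoid G → Bool`. A weak limit gives measure `f u` to the clopen set of the `D` that contain
`u`. It is carried by the downward closed directed sets, as these are defined by countably many
clopen conditions, thanks to least common multiples; and it does not charge those with a largest
element, as the weights of a fixed trace eventually vanish. Such sets come from infinite traces, so
that the limit can be transported to the boundary. Uniqueness holds because the cylinders form a
π-system.
-/

namespace TraceMonoid

/-! ### Letters, cancellation and common multiples -/

section Combinatorics

variable {A : Type*} {G : SimpleGraph A}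

theorem letter_comm {a b : A} (h : G.Adj a b) :
    letter G a * letter G b = letter G b * letter G a :=
  PresentedMonoid.mk_eq_mk_of_rel (TraceRel.swap a b h)

theorem exists_list (u : TraceMonoid G) : ∃ l : List A, u = (l.map (letter G)).prod := by
  obtain ⟨w, rfl⟩ := PresentedMonoid.surjective_mk u
  induction w with
  | one => exact ⟨[], rfl⟩
  | of a => exact ⟨[a], by simp [letter, PresentedMonoid.of]⟩
  | mul x y hx hy =>
    obtain ⟨l, hl⟩ := hx
    obtain ⟨m, hm⟩ := hy
    exact ⟨l ++ m, by simp [hl, hm]⟩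

theorem letter_mul_induction {p : TraceMonoid G → Prop} (one : p 1)
    (mul : ∀ a u, p u → p (letter G a * u)) (u : TraceMonoid G) : p u := by
  obtain ⟨l, rfl⟩ := exists_list u
  induction l with
  | nil => exact one
  | cons a l ih => simpa using mul a _ ih

theorem mul_letter_induction {p : TraceMonoid G → Prop} (one : p 1)
    (mul : ∀ u a, p u → p (u * letter G a)) (u : TraceMonoid G) : p u := by
  obtain ⟨l, rfl⟩ := exists_list u
  induction l using List.reverseRecOn with
  | nil => exact one
  | append_singleton l a ih => simpa using mul _ a ih

/-- Lifting a map on letters to a homomorphism of the trace monoid. -/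
def lift {M : Type*} [Monoid M] (φ : A → M)
    (h : ∀ a b, G.Adj a b → φ a * φ b = φ b * φ a) : TraceMonoid G →* M :=
  PresentedMonoid.lift φ (by
    rintro _ _ ⟨a, b, hab⟩
    simpa using h a b hab)

@[simp]
theorem lift_letter {M : Type*} [Monoid M] (φ : A → M)
    (h : ∀ a b, G.Adj a b → φ a * φ b = φ b * φ a) (a : A) :
    lift φ h (letter G a) = φ a :=
  PresentedMonoid.lift_of φ _

@[simp]
theorem length_one : length (1 : TraceMonoid G) = 0 := by simp [length]

@[simp]
theorem length_mul (u v : TraceMonoid G) : length (u * v) = length u + length v := by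
  simp [length]

@[simp]
theorem length_letter (a : A) : length (letter G a) = 1 := rfl

open Classical in
/-- The number of occurrences of the letter `a` in a trace. -/
noncomputable def count (a : A) (u : TraceMonoid G) : ℕ :=
  Multiplicative.toAdd (lift (G := G)
    (fun b => Multiplicative.ofAdd (if b = a then 1 else 0)) (fun _ _ _ => mul_comm _ _) u)

@[simp]
theorem count_one (a : A) : count a (1 : TraceMonoid G) = 0 := by simp [count]

@[simp]
theorem count_mul (a : A) (u v : TraceMonoid G) : count a (u * v) = count a u + count a v := by
  simp [count]

@[simp]
theorem count_letter_self (a : A) : count a (letter G a) = 1 := by simp [count]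

theorem count_letter_of_ne {a b : A} (h : b ≠ a) : count a (letter G b) = 0 := by
  simp [count, h]

theorem count_le_of_dvd (a : A) {u v : TraceMonoid G} (h : u ∣ v) : count a u ≤ count a v := by
  obtain ⟨w, rfl⟩ := h
  simp

theorem eq_one_or_exists_letter_dvd (u : TraceMonoid G) : u = 1 ∨ ∃ a, letter G a ∣ u := by
  induction u using letter_mul_induction with
  | one => exact Or.inl rfl
  | mul a u _ => exact Or.inr ⟨a, dvd_mul_right _ _⟩

theorem not_letter_dvd_one (a : A) : ¬ letter G a ∣ 1 := fun h => by
  simpa using count_le_of_dvd a h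

open Classical in
/-- The action of the trace monoid on pairs `(u, e)` of traces behind `erase`: along it, `e` is
the result of erasing the first `a` from `u`. -/
noncomputable def eraseHom (a : A) :
    TraceMonoid G →* Function.End (TraceMonoid G × TraceMonoid G) :=
  lift (fun b p => (letter G b * p.1, if b = a then p.1 else letter G b * p.2)) (by
    intro b c h
    funext p
    show (letter G b * (letter G c * p.1),
        if b = a then letter G c * p.1
          else letter G b * if c = a then p.1 else letter G c * p.2) =
      (letter G c * (letter G b * p.1),
        if c = a then letter G b * p.1
          else letter G c * if b = a then p.1 else letter G b * p.2)
    have hne := h.ne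
    simp only [← mul_assoc, letter_comm h]
    by_cases hb : b = a
    · have hc : c ≠ a := fun hc => hne (hb.trans hc.symm)
      simp [hb, hc]
    · by_cases hc : c = a
      · simp [hb, hc]
      · simp [hb, hc, ← mul_assoc, letter_comm h])

open Classical in
theorem eraseHom_letter (a b : A) (p : TraceMonoid G × TraceMonoid G) :
    eraseHom a (letter G b) p =
      (letter G b * p.1, if b = a then p.1 else letter G b * p.2) := rfl

theorem eraseHom_fst (a : A) (u : TraceMonoid G) : (eraseHom a u (1, 1)).1 = u := by
  induction u using letter_mul_induction with
  | one => rw [map_one]; rfl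
  | mul b u ih =>
    rw [map_mul]
    show (eraseHom a (letter G b) (eraseHom a u (1, 1))).1 = _
    rw [eraseHom_letter, ih]

/-- The trace obtained by erasing the first occurrence of the letter `a`. -/
noncomputable def erase (a : A) (u : TraceMonoid G) : TraceMonoid G := (eraseHom a u (1, 1)).2

open Classical in
theorem erase_letter_mul (a b : A) (u : TraceMonoid G) :
    erase a (letter G b * u) = if b = a then u else letter G b * erase a u := by
  have h : erase a (letter G b * u) =
      (eraseHom a (letter G b) (eraseHom a u (1, 1))).2 := by
    rw [erase, map_mul]; rfl
  rw [h, eraseHom_letter, eraseHom_fst, erase]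

theorem letter_mul_left_cancel {a : A} {u v : TraceMonoid G}
    (h : letter G a * u = letter G a * v) : u = v := by
  simpa [erase_letter_mul] using congrArg (erase a) h

theorem left_cancel {w u v : TraceMonoid G} (h : w * u = w * v) : u = v := by
  induction w using letter_mul_induction with
  | one => simpa using h
  | mul a w ih =>
    rw [mul_assoc, mul_assoc] at h
    exact ih (letter_mul_left_cancel h)

instance : IsLeftCancelMul (TraceMonoid G) where
  mul_left_cancel _ _ _ h := left_cancel h

/-- Reversal of traces, as a homomorphism to the opposite monoid. -/
def reverseHom : TraceMonoid G →* (TraceMonoid G)ᵐᵒᵖ :=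
  lift (fun a => MulOpposite.op (letter G a)) (by
    intro a b h
    rw [← MulOpposite.op_mul, ← MulOpposite.op_mul, letter_comm h])

/-- The reversal of a trace. -/
def reverse (u : TraceMonoid G) : TraceMonoid G := (reverseHom u).unop

@[simp]
theorem reverse_one : reverse (1 : TraceMonoid G) = 1 := by simp [reverse]

@[simp]
theorem reverse_mul (u v : TraceMonoid G) : reverse (u * v) = reverse v * reverse u := by
  simp [reverse]

@[simp]
theorem reverse_letter (a : A) : reverse (letter G a) = letter G a := by
  simp [reverse, reverseHom]

@[simp]
theorem reverse_reverse (u : TraceMonoid G) : reverse (reverse u) = u := by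
  induction u using letter_mul_induction with
  | one => simp
  | mul a u ih => simp [ih]

instance : IsRightCancelMul (TraceMonoid G) where
  mul_right_cancel w u v h := by
    have h' := congrArg reverse h
    simp only [reverse_mul] at h'
    simpa using congrArg reverse (mul_left_cancel h')

theorem mul_dvd_mul_iff {w u v : TraceMonoid G} : w * u ∣ w * v ↔ u ∣ v := by
  refine ⟨?_, mul_dvd_mul_left w⟩
  rintro ⟨x, hx⟩
  exact ⟨x, mul_left_cancel (by rwa [mul_assoc] at hx)⟩

open Classical in
/-- Dependent letters cannot both start a trace: the order of their occurrences is kept by the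
projection to words in these two letters. -/
theorem adj_of_letter_dvd {a b : A} {u : TraceMonoid G} (hab : a ≠ b)
    (ha : letter G a ∣ u) (hb : letter G b ∣ u) : G.Adj a b := by
  by_contra hG
  obtain ⟨x, rfl⟩ := ha
  obtain ⟨y, hy⟩ := hb
  have := congrArg (lift (G := G)
    (fun c => if c = a ∨ c = b then FreeMonoid.of c else 1) (by
      intro c d h
      split_ifs with hc hd
      · rcases hc with rfl | rfl <;> rcases hd with rfl | rfl
        · rfl
        · exact absurd h hG
        · exact absurd h.symm hG
        · rfl
      · simp
      · simp
      · simp)) hy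
  simp only [map_mul, lift_letter, true_or, or_true, if_true] at this
  have := congrArg FreeMonoid.toList this
  simp only [FreeMonoid.toList_mul, FreeMonoid.toList_of, List.singleton_append,
    List.cons.injEq] at this
  exact hab this.1

theorem exists_eq_of_letter_dvd {a b : A} {u : TraceMonoid G} (hab : a ≠ b)
    (ha : letter G a ∣ u) (hb : letter G b ∣ u) :
    ∃ v, u = letter G b * (letter G a * v) := by
  obtain ⟨x, rfl⟩ := ha
  obtain ⟨y, hy⟩ := hb
  have h := congrArg (erase b) hy
  simp only [erase_letter_mul, if_neg hab, if_true] at h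
  exact ⟨erase b x, by rw [hy, ← h]⟩

/-- The basic dichotomy for a letter `a` and a trace `v` with a common multiple. -/
theorem letter_dvd_or {a : A} {v : TraceMonoid G} : ∀ {u : TraceMonoid G}, letter G a ∣ u →
    v ∣ u → letter G a ∣ v ∨
      ((∀ b, 0 < count b v → G.Adj a b) ∧ v * letter G a ∣ u ∧
        letter G a * v = v * letter G a) := by
  induction v using letter_mul_induction with
  | one =>
    intro u ha _
    exact Or.inr ⟨fun b hb => by simp at hb, by simpa using ha, by simp⟩
  | mul b v ih =>
    intro u ha hv
    have hb : letter G b ∣ u := (dvd_mul_right _ _).trans hv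
    by_cases hab : a = b
    · subst hab
      exact Or.inl (dvd_mul_right _ _)
    have hadj := adj_of_letter_dvd hab ha hb
    obtain ⟨x, rfl⟩ := exists_eq_of_letter_dvd hab ha hb
    rw [mul_dvd_mul_iff] at hv
    rcases ih (dvd_mul_right _ _) hv with h | ⟨h1, h2, h3⟩
    · obtain ⟨y, rfl⟩ := h
      left
      rw [← mul_assoc, ← letter_comm hadj, mul_assoc]
      exact dvd_mul_right _ _
    · refine Or.inr ⟨fun c hc => ?_, ?_, ?_⟩
      · by_cases hbc : b = c
        · exact hbc ▸ hadj
        · rw [count_mul, count_letter_of_ne hbc, zero_add] at hc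
          exact h1 c hc
      · rw [mul_assoc]
        exact mul_dvd_mul_left _ h2
      · rw [← mul_assoc, letter_comm hadj, mul_assoc, h3, mul_assoc]

/-- Two traces with a common multiple have a least one. -/
theorem exists_lcm {u v x : TraceMonoid G} (hu : u ∣ x) (hv : v ∣ x) :
    ∃ z, u ∣ z ∧ v ∣ z ∧ ∀ y, u ∣ y → v ∣ y → z ∣ y := by
  induction u using letter_mul_induction generalizing v x with
  | one => exact ⟨v, one_dvd _, dvd_rfl, fun y _ h => h⟩
  | mul a u ih =>
    have ha : letter G a ∣ x := (dvd_mul_right _ _).trans hu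
    by_cases hav : letter G a ∣ v
    · obtain ⟨v, rfl⟩ := hav
      obtain ⟨x, rfl⟩ := ha
      obtain ⟨z, h1, h2, h3⟩ := ih (mul_dvd_mul_iff.1 hu) (mul_dvd_mul_iff.1 hv)
      refine ⟨letter G a * z, mul_dvd_mul_left _ h1, mul_dvd_mul_left _ h2, ?_⟩
      intro y hy hy'
      obtain ⟨y, rfl⟩ := (dvd_mul_right _ _).trans hy
      rw [mul_dvd_mul_iff] at hy hy' ⊢
      exact h3 y hy hy'
    · -- `a` commutes with `v`, so that a common multiple of `a` and `v` is one of `a * v`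
      have key : ∀ y, letter G a ∣ y → v ∣ y → letter G a * v ∣ y := by
        intro y h h'
        rcases letter_dvd_or h h' with h | ⟨_, h2, h3⟩
        · exact absurd h hav
        · rwa [h3]
      have hcomm : letter G a * v = v * letter G a := by
        rcases letter_dvd_or ha hv with h | ⟨_, _, h⟩
        · exact absurd h hav
        · exact h
      have hv' := key x ha hv
      obtain ⟨x, rfl⟩ := ha
      obtain ⟨z, h1, h2, h3⟩ := ih (mul_dvd_mul_iff.1 hu) (mul_dvd_mul_iff.1 hv')
      refine ⟨letter G a * z, mul_dvd_mul_left _ h1, ?_, ?_⟩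
      · refine Dvd.dvd.trans ?_ (mul_dvd_mul_left _ h2)
        rw [hcomm]
        exact dvd_mul_right _ _
      · intro y hy hy'
        have h' := key y ((dvd_mul_right _ _).trans hy) hy'
        obtain ⟨y, rfl⟩ := (dvd_mul_right _ _).trans hy
        exact mul_dvd_mul_left _ (h3 y (mul_dvd_mul_iff.1 hy) (mul_dvd_mul_iff.1 h'))

/-! ### Cliques as finite sets of letters -/

/-- The product of a finite set of letters, in some order; it is meant for sets of pairwise
independent letters, for which the order is irrelevant. -/
noncomputable def prodLetters (G : SimpleGraph A) (S : Finset A) : TraceMonoid G :=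
  (S.toList.map (letter G)).prod

/-- A finite set of pairwise independent letters. -/
abbrev Indep (G : SimpleGraph A) (S : Finset A) : Prop := G.IsClique (S : Set A)

theorem prodLetters_eq {S : Finset A} (hS : Indep G S) {l : List A} (hl : l.Perm S.toList) :
    (l.map (letter G)).prod = prodLetters G S := by
  refine (hl.map _).prod_eq' ?_
  rw [List.pairwise_map]
  refine List.Pairwise.imp_of_mem (R := fun a b => a ≠ b) ?_
    (hl.nodup_iff.2 (Finset.nodup_toList S))
  intro a b ha hb hab
  refine letter_comm (hS ?_ ?_ hab)
  · simpa using hl.subset ha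
  · simpa using hl.subset hb

@[simp]
theorem prodLetters_empty : prodLetters G ∅ = 1 := by simp [prodLetters]

open Classical in
theorem prodLetters_insert {a : A} {S : Finset A} (ha : a ∉ S) (hS : Indep G (insert a S)) :
    prodLetters G (insert a S) = letter G a * prodLetters G S := by
  rw [← prodLetters_eq hS (Finset.toList_insert ha).symm]
  simp [prodLetters]

theorem Indep.mono {S T : Finset A} (hT : Indep G T) (h : S ⊆ T) : Indep G S :=
  Set.Pairwise.mono (Finset.coe_subset.2 h) hT

open Classical in
theorem count_prodLetters {S : Finset A} (hS : Indep G S) (a : A) :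
    count a (prodLetters G S) = if a ∈ S then 1 else 0 := by
  induction S using Finset.induction_on with
  | empty => simp
  | insert b S hb ih =>
    rw [prodLetters_insert hb hS, count_mul, ih (hS.mono (Finset.subset_insert _ _))]
    by_cases hab : b = a
    · subst hab
      simp [hb]
    · rw [count_letter_of_ne hab]
      simp [Ne.symm hab]

open Classical in
theorem length_prodLetters {S : Finset A} (hS : Indep G S) :
    length (prodLetters G S) = S.card := by
  induction S using Finset.induction_on with
  | empty => simp
  | insert b S hb ih =>
    rw [prodLetters_insert hb hS, length_mul, ih (hS.mono (Finset.subset_insert _ _)),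
      length_letter, Finset.card_insert_of_notMem hb, add_comm]

open Classical in
theorem reverse_prodLetters {S : Finset A} (hS : Indep G S) :
    reverse (prodLetters G S) = prodLetters G S := by
  have h : ∀ l : List A, reverse ((l.map (letter G)).prod) = (l.reverse.map (letter G)).prod := by
    intro l
    induction l with
    | nil => simp
    | cons a l ih => simp [ih]
  rw [prodLetters, h, prodLetters_eq hS (List.reverse_perm _), prodLetters]

open Classical in
theorem prodLetters_insert_right {a : A} {S : Finset A} (ha : a ∉ S)
    (hS : Indep G (insert a S)) :
    prodLetters G (insert a S) = prodLetters G S * letter G a := by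
  have := reverse_prodLetters hS
  rwa [prodLetters_insert ha hS, reverse_mul,
    reverse_prodLetters (hS.mono (Finset.subset_insert _ _)), reverse_letter, eq_comm,
    ← prodLetters_insert ha hS] at this

open Classical in
theorem prodLetters_union {S T : Finset A} (hST : Disjoint S T) (h : Indep G (S ∪ T)) :
    prodLetters G (S ∪ T) = prodLetters G S * prodLetters G T := by
  induction T using Finset.induction_on with
  | empty => simp
  | insert b T hb ih =>
    rw [Finset.disjoint_insert_right] at hST
    rw [Finset.union_insert] at h ⊢
    rw [prodLetters_insert_right (by simp [hST.1, hb]) h,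
      prodLetters_insert_right hb (h.mono (Finset.insert_subset_insert _ Finset.subset_union_right)),
      ih hST.2 (h.mono (Finset.subset_insert _ _)), mul_assoc]

open Classical in
/-- A clique lies below a trace as soon as all its letters do. -/
theorem prodLetters_dvd_iff {S : Finset A} (hS : Indep G S) {u : TraceMonoid G} :
    prodLetters G S ∣ u ↔ ∀ a ∈ S, letter G a ∣ u := by
  induction S using Finset.induction_on with
  | empty => simp
  | insert b S hb ih =>
    have hS' := hS.mono (Finset.subset_insert b S)
    rw [prodLetters_insert_right hb hS]
    constructor
    · intro h a ha
      rcases Finset.mem_insert.1 ha with rfl | ha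
      · rw [← prodLetters_insert_right hb hS, prodLetters_insert hb hS] at h
        exact (dvd_mul_right _ _).trans h
      · exact (ih hS').1 ((dvd_mul_right _ _).trans h) a ha
    · intro h
      have h1 := (ih hS').2 fun a ha => h a (Finset.mem_insert_of_mem ha)
      rcases letter_dvd_or (h b (Finset.mem_insert_self _ _)) h1 with h2 | ⟨_, h2, _⟩
      · have := count_le_of_dvd b h2
        simp [count_prodLetters hS', hb] at this
      · exact h2

theorem isClique_prodLetters {S : Finset A} (hS : Indep G S) : IsClique (prodLetters G S) := by
  refine ⟨S.toList, ?_, rfl⟩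
  refine List.Pairwise.imp_of_mem ?_ (Finset.nodup_toList S)
  intro a b ha hb hab
  exact hS (by simpa using ha) (by simpa using hb) hab

open Classical in
theorem exists_prodLetters {c : TraceMonoid G} (hc : IsClique c) :
    ∃ S : Finset A, Indep G S ∧ c = prodLetters G S := by
  obtain ⟨l, hl, rfl⟩ := hc
  have hnd : l.Nodup := hl.imp fun h => h.ne
  have hind : Indep G l.toFinset := by
    intro a ha b hb hab
    have : Std.Symm G.Adj := ⟨fun _ _ h => h.symm⟩
    exact hl.forall (by simpa using ha) (by simpa using hb) hab
  exact ⟨l.toFinset, hind, prodLetters_eq hind (List.toFinset_toList hnd).symm⟩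

theorem prodLetters_injective {S T : Finset A} (hS : Indep G S) (hT : Indep G T)
    (h : prodLetters G S = prodLetters G T) : S = T := by
  classical
  ext a
  have := congrArg (count a) h
  rw [count_prodLetters hS, count_prodLetters hT] at this
  by_cases h1 : a ∈ S <;> by_cases h2 : a ∈ T <;> simp_all

theorem prodLetters_dvd_prodLetters {S T : Finset A} (hS : Indep G S) (hT : Indep G T) :
    prodLetters G S ∣ prodLetters G T ↔ S ⊆ T := by
  classical
  constructor
  · intro h a ha
    by_contra hn
    have := count_le_of_dvd a h
    simp [count_prodLetters hS, count_prodLetters hT, ha, hn] at this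
  · intro h
    exact (prodLetters_dvd_iff hS).2 fun a ha => (prodLetters_dvd_iff hT).1 dvd_rfl a (h ha)

theorem letter_dvd_prodLetters {S : Finset A} (hS : Indep G S) {a : A} :
    letter G a ∣ prodLetters G S ↔ a ∈ S := by
  classical
  constructor
  · intro h
    by_contra hn
    have := count_le_of_dvd a h
    simp [count_prodLetters hS, hn] at this
  · exact (prodLetters_dvd_iff hS).1 dvd_rfl a

end Combinatorics

/-! ### The Möbius transform as a sum over sets of letters -/

section Mobius

variable {A : Type*} {G : SimpleGraph A}

/-- The clique with a given set of letters. -/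
noncomputable def cliqueOf {S : Finset A} (hS : Indep G S) : Clique G :=
  ⟨prodLetters G S, isClique_prodLetters hS⟩

open Classical in
theorem sum_neg_one_pow_card_sub [Fintype A] (C T : Finset A) :
    ∑ S : Finset A with C ⊆ S ∧ S ⊆ T, (-1 : ℝ) ^ (S.card - C.card) =
      if C = T then 1 else 0 := by
  by_cases hCT : C ⊆ T
  · have h : ∑ S : Finset A with C ⊆ S ∧ S ⊆ T, (-1 : ℝ) ^ (S.card - C.card) =
        ∑ S ∈ (T \ C).powerset, (-1 : ℝ) ^ S.card := by
      refine Finset.sum_bij' (fun S _ => S \ C) (fun S _ => C ∪ S) ?_ ?_ ?_ ?_ ?_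
      · intro S hS
        simp only [Finset.mem_filter, Finset.mem_univ, true_and] at hS
        exact Finset.mem_powerset.2 (Finset.sdiff_subset_sdiff hS.2 le_rfl)
      · intro S hS
        rw [Finset.mem_powerset] at hS
        simp only [Finset.mem_filter, Finset.mem_univ, true_and]
        exact ⟨Finset.subset_union_left,
          Finset.union_subset hCT (hS.trans Finset.sdiff_subset)⟩
      · intro S hS
        simp only [Finset.mem_filter, Finset.mem_univ, true_and] at hS
        exact Finset.union_sdiff_of_subset hS.1
      · intro S hS
        rw [Finset.mem_powerset] at hS
        rw [Finset.union_sdiff_cancel_left]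
        exact Finset.disjoint_of_subset_right hS Finset.disjoint_sdiff
      · intro S hS
        simp only [Finset.mem_filter, Finset.mem_univ, true_and] at hS
        rw [Finset.card_sdiff_of_subset hS.1]
    have h' : ∑ S ∈ (T \ C).powerset, (-1 : ℝ) ^ S.card = if T \ C = ∅ then 1 else 0 := by
      exact_mod_cast congrArg (Int.cast : ℤ → ℝ)
        (Finset.sum_powerset_neg_one_pow_card (x := T \ C))
    rw [h, h']
    refine if_congr ?_ rfl rfl
    rw [Finset.sdiff_eq_empty_iff_subset]
    exact ⟨fun h => hCT.antisymm h, fun h => h.ge⟩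
  · rw [if_neg (show ¬ C = T from fun h => hCT h.le), Finset.filter_false_of_mem, Finset.sum_empty]
    rintro S - ⟨h1, h2⟩
    exact hCT (h1.trans h2)

open Classical in
/-- The alternating sum behind both inclusion-exclusion on the boundary, where `T` is the set of
the letters below an infinite trace, and Möbius inversion on traces. -/
theorem sum_indep_indicator [Fintype A] (C : Finset A) {T : Finset A} (hT : Indep G T) :
    ∑ S : Finset A with Indep G S ∧ C ⊆ S,
      (-1 : ℝ) ^ (S.card - C.card) * (if S ⊆ T then 1 else 0) = if C = T then 1 else 0 := by
  rw [← sum_neg_one_pow_card_sub C T]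
  simp only [mul_ite, mul_one, mul_zero]
  rw [← Finset.sum_filter, Finset.filter_filter]
  refine Finset.sum_congr ?_ fun _ _ => rfl
  ext S
  simp only [Finset.mem_filter, Finset.mem_univ, true_and]
  exact ⟨fun h => ⟨h.1.2, h.2⟩, fun h => ⟨⟨hT.mono h.2, h.1⟩, h.2⟩⟩

open Classical in
theorem mobiusTransform_cliqueOf [Fintype A] (f : TraceMonoid G → ℝ) {C : Finset A}
    (hC : Indep G C) :
    mobiusTransform (fun c : Clique G => f c.1) (cliqueOf hC) =
      ∑ S : Finset A with Indep G S ∧ C ⊆ S,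
        (-1 : ℝ) ^ (S.card - C.card) * f (prodLetters G S) := by
  rw [mobiusTransform]
  symm
  refine Finset.sum_bij (fun S hS => cliqueOf (Finset.mem_filter.1 hS).2.1) ?_ ?_ ?_ ?_
  · intro S hS
    simp only [Finset.mem_filter, Finset.mem_univ, true_and] at hS ⊢
    exact (prodLetters_dvd_prodLetters hC hS.1).2 hS.2
  · intro S hS T hT h
    exact prodLetters_injective (Finset.mem_filter.1 hS).2.1 (Finset.mem_filter.1 hT).2.1
      (congrArg Subtype.val h)
  · rintro ⟨c, hc⟩ hCc
    simp only [Finset.mem_filter, Finset.mem_univ, true_and] at hCc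
    obtain ⟨S, hS, rfl⟩ := exists_prodLetters hc
    exact ⟨S, Finset.mem_filter.2
      ⟨Finset.mem_univ _, hS, (prodLetters_dvd_prodLetters hC hS).1 hCc⟩, rfl⟩
  · intro S hS
    simp only [Finset.mem_filter, Finset.mem_univ, true_and] at hS
    simp only [cliqueOf, length_prodLetters hC, length_prodLetters hS.1]

theorem indep_empty : Indep G ∅ := by simp [Indep]

theorem emptyClique_eq : emptyClique G = cliqueOf (G := G) indep_empty :=
  Subtype.ext prodLetters_empty.symm

theorem exists_cliqueOf (c : Clique G) :
    ∃ (S : Finset A) (hS : Indep G S), c = cliqueOf hS := by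
  obtain ⟨S, hS, h⟩ := exists_prodLetters c.2
  exact ⟨S, hS, Subtype.ext h⟩

theorem cliqueOf_ne_emptyClique {S : Finset A} (hS : Indep G S) :
    cliqueOf hS ≠ emptyClique G ↔ S ≠ ∅ := by
  rw [emptyClique_eq, not_iff_not]
  exact ⟨fun h => prodLetters_injective hS indep_empty (congrArg Subtype.val h),
    fun h => by subst h; rfl⟩

end Mobius

/-! ### Cylinders of the boundary -/

section Boundary

variable {A : Type*} {G : SimpleGraph A}

theorem NondecSeq.dvd_of_le (s : NondecSeq G) {j k : ℕ} (h : j ≤ k) : s.seq j ∣ s.seq k := by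
  induction h with
  | refl => exact dvd_rfl
  | step _ ih => exact ih.trans (s.nondec _)

theorem toGeneralized_le_iff (s : NondecSeq G) (u : TraceMonoid G) :
    toGeneralized u ≤ toAntisymmetrization (· ≤ ·) s ↔ ∃ k, u ∣ s.seq k :=
  ⟨fun h => h 0, fun h _ => h⟩

theorem toAntisymmetrization_mem_range_iff (s : NondecSeq G) :
    toAntisymmetrization (· ≤ ·) s ∈ Set.range (toGeneralized (G := G)) ↔
      ∃ u, (∃ k, u ∣ s.seq k) ∧ ∀ k, s.seq k ∣ u := by
  constructor
  · rintro ⟨u, hu⟩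
    refine ⟨u, (toGeneralized_le_iff s u).1 hu.le, fun k => ?_⟩
    obtain ⟨_, h⟩ := (show s ≤ ⟨fun _ => u, fun _ => dvd_refl u⟩ from hu.ge) k
    exact h
  · rintro ⟨u, hu, hs⟩
    exact ⟨u, le_antisymm ((toGeneralized_le_iff s u).2 hu) (fun k => ⟨0, hs k⟩)⟩

theorem exists_seq (ξ : Boundary G) :
    ∃ s : NondecSeq G, (∀ u, ξ ∈ cylinder u ↔ ∃ k, u ∣ s.seq k) ∧
      ¬ ∃ u, (∃ k, u ∣ s.seq k) ∧ ∀ k, s.seq k ∣ u := by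
  obtain ⟨ξ, hξ⟩ := ξ
  induction ξ using Quotient.inductionOn with
  | h s =>
    exact ⟨s, fun u => toGeneralized_le_iff s u,
      fun h => hξ ((toAntisymmetrization_mem_range_iff s).2 h)⟩

theorem cylinder_one : cylinder (1 : TraceMonoid G) = Set.univ := by
  refine Set.eq_univ_of_forall fun ξ => ?_
  obtain ⟨s, hs, _⟩ := exists_seq ξ
  exact (hs 1).2 ⟨0, one_dvd _⟩

theorem cylinder_anti {u v : TraceMonoid G} (h : u ∣ v) : cylinder v ⊆ cylinder u := by
  intro ξ hξ
  obtain ⟨s, hs, _⟩ := exists_seq ξ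
  obtain ⟨k, hk⟩ := (hs v).1 hξ
  exact (hs u).2 ⟨k, h.trans hk⟩

/-- The traces below an infinite trace form a directed set. -/
theorem exists_common_multiple {ξ : Boundary G} {u v : TraceMonoid G} (hu : ξ ∈ cylinder u)
    (hv : ξ ∈ cylinder v) : ∃ x, ξ ∈ cylinder x ∧ u ∣ x ∧ v ∣ x := by
  obtain ⟨s, hs, _⟩ := exists_seq ξ
  obtain ⟨j, hj⟩ := (hs u).1 hu
  obtain ⟨k, hk⟩ := (hs v).1 hv
  exact ⟨s.seq (max j k), (hs _).2 ⟨_, dvd_rfl⟩, hj.trans (s.dvd_of_le (le_max_left _ _)),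
    hk.trans (s.dvd_of_le (le_max_right _ _))⟩

theorem exists_mem_cylinder_letter (ξ : Boundary G) : ∃ a, ξ ∈ cylinder (letter G a) := by
  obtain ⟨s, hs, hs'⟩ := exists_seq ξ
  by_contra! h
  refine hs' ⟨1, ⟨0, one_dvd _⟩, fun k => ?_⟩
  rcases eq_one_or_exists_letter_dvd (s.seq k) with h1 | ⟨a, ha⟩
  · rw [h1]
  · exact absurd ((hs _).2 ⟨k, ha⟩) (h a)

theorem mem_cylinder_prodLetters_iff {S : Finset A} (hS : Indep G S) {ξ : Boundary G} :
    ξ ∈ cylinder (prodLetters G S) ↔ ∀ a ∈ S, ξ ∈ cylinder (letter G a) := by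
  classical
  induction S using Finset.induction_on with
  | empty => simp [cylinder_one]
  | insert b S hb ih =>
    have hS' := hS.mono (Finset.subset_insert b S)
    constructor
    · intro h a ha
      exact cylinder_anti ((letter_dvd_prodLetters hS).2 ha) h
    · intro h
      have h1 := (ih hS').2 fun a ha => h a (Finset.mem_insert_of_mem ha)
      obtain ⟨x, hx, hx1, hx2⟩ := exists_common_multiple (h b (Finset.mem_insert_self _ _)) h1
      refine cylinder_anti ((prodLetters_dvd_iff hS).2 fun a ha => ?_) hx
      rcases Finset.mem_insert.1 ha with rfl | ha
      · exact hx1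
      · exact ((letter_dvd_prodLetters hS').2 ha).trans hx2

open Classical in
/-- The letters below an infinite trace. -/
noncomputable def firstLetters [Fintype A] (ξ : Boundary G) : Finset A :=
  {a | ξ ∈ cylinder (letter G a)}

theorem mem_firstLetters [Fintype A] {ξ : Boundary G} {a : A} :
    a ∈ firstLetters ξ ↔ ξ ∈ cylinder (letter G a) := by
  simp [firstLetters]

theorem indep_firstLetters [Fintype A] (ξ : Boundary G) : Indep G (firstLetters ξ) := by
  intro a ha b hb hab
  obtain ⟨x, _, hx1, hx2⟩ := exists_common_multiple (mem_firstLetters.1 ha)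
    (mem_firstLetters.1 hb)
  exact adj_of_letter_dvd hab hx1 hx2

theorem firstLetters_ne_empty [Fintype A] (ξ : Boundary G) : firstLetters ξ ≠ ∅ := by
  obtain ⟨a, ha⟩ := exists_mem_cylinder_letter ξ
  exact Finset.ne_empty_of_mem (mem_firstLetters.2 ha)

theorem measurableSet_cylinder (u : TraceMonoid G) : MeasurableSet (cylinder u) :=
  MeasurableSpace.measurableSet_generateFrom ⟨u, rfl⟩

/-- Cylinders form a π-system, because traces with a common multiple have a least one. -/
theorem isPiSystem_cylinder : IsPiSystem (Set.range (cylinder (G := G))) := by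
  rintro _ ⟨u, rfl⟩ _ ⟨v, rfl⟩ ⟨ξ, hu, hv⟩
  obtain ⟨x, _, hx1, hx2⟩ := exists_common_multiple hu hv
  obtain ⟨z, hz1, hz2, hz⟩ := exists_lcm hx1 hx2
  refine ⟨z, Set.Subset.antisymm (Set.subset_inter (cylinder_anti hz1) (cylinder_anti hz2)) ?_⟩
  rintro η ⟨hu', hv'⟩
  obtain ⟨y, hy, hy1, hy2⟩ := exists_common_multiple hu' hv'
  exact cylinder_anti (hz y hy1 hy2) hy

end Boundary

/-! ### Bernoulli measures define Möbius valuations -/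

section Bernoulli

variable {A : Type*} {G : SimpleGraph A}

/-- In an irreducible trace monoid, every non-empty clique `c` has a multiple `v` that pins it:
every multiple of `v` has exactly the first letters of `c`. The trace `v` is built from `c` by
appending new letters one at a time, each dependent on a letter that is already there, until every
letter occurs. -/
theorem exists_pinning_trace [Fintype A] (hG : IsIrreducible G) {C : Finset A} (hC : Indep G C)
    (hne : C ≠ ∅) :
    ∃ v : TraceMonoid G, prodLetters G C ∣ v ∧
      ∀ x, v ∣ x → ∀ a, letter G a ∣ x → a ∈ C := by
  classical
  let p : Finset A → Prop := fun B => ∃ v : TraceMonoid G, prodLetters G C ∣ v ∧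
    (∀ a, letter G a ∣ v → a ∈ C) ∧ ∀ a ∈ B, 0 < count a v
  have hpC : p C := by
    refine ⟨prodLetters G C, dvd_rfl, fun a => (letter_dvd_prodLetters hC).1, fun a ha => ?_⟩
    simp [count_prodLetters hC, ha]
  obtain ⟨B, hCB, hB⟩ := (Set.toFinite {B | p B}).exists_le_maximal hpC
  obtain ⟨v, hCv, hv, hBv⟩ := hB.prop
  have hmax : ∀ b, 0 < count b v → b ∈ B := by
    intro b hb
    have : p (insert b B) := ⟨v, hCv, hv, by
      intro a ha
      rcases Finset.mem_insert.1 ha with rfl | ha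
      · exact hb
      · exact hBv a ha⟩
    exact hB.le_of_ge this (Finset.subset_insert b B) (Finset.mem_insert_self b B)
  have huniv : ∀ b, b ∈ B := by
    by_contra! h
    obtain ⟨b, hb⟩ := h
    obtain ⟨c, hc⟩ := Finset.nonempty_iff_ne_empty.2 hne
    obtain ⟨w⟩ := hG.preconnected c b
    obtain ⟨d, -, hd1, hd2⟩ := w.exists_boundary_dart (B : Set A) (hCB hc) hb
    have hdep : d.fst ≠ d.snd ∧ ¬ G.Adj d.fst d.snd :=
      (SimpleGraph.compl_adj G _ _).1 d.adj
    have hp : p (insert d.snd B) := by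
      refine ⟨v * letter G d.snd, hCv.trans (dvd_mul_right _ _), fun a ha => ?_, fun a ha => ?_⟩
      · rcases letter_dvd_or ha (dvd_mul_right v _) with h | ⟨h1, h2, _⟩
        · exact hv a h
        · have h3 := count_le_of_dvd a (mul_dvd_mul_iff.1 h2)
          have : d.snd = a := by
            by_contra hn
            simp [count_letter_of_ne hn] at h3
          subst this
          exact absurd (h1 _ (hBv _ hd1)).symm hdep.2
      · rw [count_mul]
        rcases Finset.mem_insert.1 ha with rfl | ha
        · simp
        · exact Nat.add_pos_left (hBv a ha) _
    exact hd2 (hB.le_of_ge hp (Finset.subset_insert _ B) (Finset.mem_insert_self _ B))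
  refine ⟨v, hCv, fun x hx a ha => ?_⟩
  rcases letter_dvd_or ha hx with h | ⟨h, _, _⟩
  · exact hv a h
  · exact absurd (h a (hBv a (huniv a))) (G.irrefl)

theorem measurableSet_firstLetters_eq [Fintype A] (C : Finset A) :
    MeasurableSet {ξ : Boundary G | C = firstLetters ξ} := by
  have h : {ξ : Boundary G | C = firstLetters ξ} =
      ⋂ a : A, {ξ | a ∈ C ↔ ξ ∈ cylinder (letter G a)} := by
    ext ξ
    simp only [Set.mem_ofPred_eq, Set.mem_iInter, Finset.ext_iff, mem_firstLetters]
  rw [h]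
  refine MeasurableSet.iInter fun a => ?_
  by_cases ha : a ∈ C
  · simpa [ha] using measurableSet_cylinder (letter G a)
  · rw [show {ξ : Boundary G | a ∈ C ↔ ξ ∈ cylinder (letter G a)} = (cylinder (letter G a))ᶜ by
      ext ξ; simp [ha]]
    exact (measurableSet_cylinder (letter G a)).compl

open Classical in
/-- Inclusion-exclusion: the Möbius transform of `u ↦ P (cylinder u)` at a clique is the
probability that the letters below an infinite trace are exactly those of the clique. -/
theorem mobiusTransform_measure [Fintype A]
    (P : MeasureTheory.Measure (Boundary G)) [MeasureTheory.IsProbabilityMeasure P]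
    {C : Finset A} (hC : Indep G C) :
    mobiusTransform (fun c : Clique G => P.real (cylinder c.1)) (cliqueOf hC) =
      P.real {ξ | C = firstLetters ξ} := by
  rw [← MeasureTheory.integral_indicator_one (measurableSet_firstLetters_eq C),
    mobiusTransform_cliqueOf (fun u => P.real (cylinder u)) hC]
  have h : ∀ ξ : Boundary G, {ξ | C = firstLetters ξ}.indicator (1 : Boundary G → ℝ) ξ =
      ∑ S : Finset A with Indep G S ∧ C ⊆ S, (-1 : ℝ) ^ (S.card - C.card) *
        (cylinder (prodLetters G S)).indicator (1 : Boundary G → ℝ) ξ := by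
    intro ξ
    refine Eq.trans (b := if C = firstLetters ξ then 1 else 0) ?_ ?_
    · simp [Set.indicator_apply]
    rw [← sum_indep_indicator C (indep_firstLetters ξ)]
    refine Finset.sum_congr rfl fun S hS => ?_
    congr 1
    rw [Set.indicator_apply, Pi.one_apply]
    refine if_congr ?_ rfl rfl
    rw [mem_cylinder_prodLetters_iff (Finset.mem_filter.1 hS).2.1]
    exact forall₂_congr fun a _ => mem_firstLetters
  simp_rw [h]
  rw [MeasureTheory.integral_finsetSum]
  · refine Finset.sum_congr rfl fun S _ => ?_
    rw [MeasureTheory.integral_const_mul,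
      MeasureTheory.integral_indicator_one (measurableSet_cylinder _)]
  · intro S _
    exact ((MeasureTheory.integrable_const (1 : ℝ)).indicator
      (measurableSet_cylinder _)).const_mul _

theorem IsBernoulli.isMobiusValuation [Finite A] (hG : IsIrreducible G)
    {P : MeasureTheory.Measure (Boundary G)} (hP : IsBernoulli P) :
    IsMobiusValuation (fun u : TraceMonoid G => P.real (cylinder u)) := by
  classical
  have := Fintype.ofFinite A
  have := hP.isProbabilityMeasure
  have hpos : ∀ u : TraceMonoid G, 0 < P.real (cylinder u) := fun u =>
    ENNReal.toReal_pos (hP.pos u).ne' (MeasureTheory.measure_ne_top _ _)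
  refine ⟨⟨hpos, fun u v => ?_⟩, ?_, fun c hc => ?_⟩
  · simp only [MeasureTheory.measureReal_def, hP.mul, ENNReal.toReal_mul]
  · rw [emptyClique_eq, mobiusTransform_measure]
    simp [fun ξ : Boundary G => (firstLetters_ne_empty ξ).symm]
  · obtain ⟨C, hC, rfl⟩ := exists_cliqueOf c
    rw [cliqueOf_ne_emptyClique] at hc
    obtain ⟨v, hCv, hv⟩ := exists_pinning_trace hG hC hc
    have hsub : ∀ ξ ∈ cylinder v, C = firstLetters ξ := by
      intro ξ hξ
      ext a
      rw [mem_firstLetters]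
      constructor
      · intro ha
        exact cylinder_anti (((letter_dvd_prodLetters hC).2 ha).trans hCv) hξ
      · intro ha
        obtain ⟨x, _, hx1, hx2⟩ := exists_common_multiple ha hξ
        exact hv x hx2 a hx1
    rw [mobiusTransform_measure]
    exact (hpos v).trans_le (MeasureTheory.measureReal_mono hsub)

end Bernoulli

/-! ### Levels of the letters of a trace -/

section Level

variable {A : Type*} {G : SimpleGraph A} [Fintype A]

open Classical in
/-- The effect of appending the letter `a` on levels: the new occurrence of `a` sits just above all
the letters that it depends on, among which `a` itself. -/
noncomputable def appendLevel (G : SimpleGraph A) (a : A) (ℓ : A → ℕ) : A → ℕ :=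
  Function.update ℓ a ((Finset.univ.filter fun b => ¬ G.Adj a b).sup ℓ + 1)

open Classical in
theorem appendLevel_comm {a b : A} (h : G.Adj a b) (ℓ : A → ℕ) :
    appendLevel G a (appendLevel G b ℓ) = appendLevel G b (appendLevel G a ℓ) := by
  have key : ∀ {a b : A}, G.Adj a b → ∀ k, (Finset.univ.filter fun c => ¬ G.Adj a c).sup
      (Function.update ℓ b k) = (Finset.univ.filter fun c => ¬ G.Adj a c).sup ℓ := by
    intro a b h k
    refine Finset.sup_congr rfl fun c hc => Function.update_of_ne ?_ _ _
    rintro rfl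
    exact (Finset.mem_filter.1 hc).2 h
  simp only [appendLevel, key h, key h.symm]
  exact Function.update_comm h.ne' _ _ _

/-- The right action of traces on levels. -/
noncomputable def levelHom (G : SimpleGraph A) :
    TraceMonoid G →* (Function.End (A → ℕ))ᵐᵒᵖ :=
  lift (fun a => MulOpposite.op (appendLevel G a)) (by
    intro a b h
    exact congrArg (MulOpposite.op (α := Function.End (A → ℕ)))
      (funext fun ℓ => appendLevel_comm h.symm ℓ))

/-- The level of the last occurrence of each letter in the heap of a trace, that is the number of
the factor of the Cartier-Foata normal form where it stands; the level is zero for the letters that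
do not occur. -/
noncomputable def level (u : TraceMonoid G) : A → ℕ := (levelHom G u).unop 0

@[simp]
theorem level_one : level (1 : TraceMonoid G) = 0 := by
  rw [level, map_one]; rfl

theorem level_mul_letter (u : TraceMonoid G) (a : A) :
    level (u * letter G a) = appendLevel G a (level u) := by
  rw [level, map_mul]; rfl

theorem appendLevel_self (a : A) (ℓ : A → ℕ) {b : A} (hb : ¬ G.Adj a b) :
    ℓ b < appendLevel G a ℓ a := by
  classical
  rw [appendLevel, Function.update_self, Nat.lt_succ_iff]
  exact Finset.le_sup (f := ℓ) (by simp [hb])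

theorem appendLevel_of_ne {a b : A} (h : b ≠ a) (ℓ : A → ℕ) : appendLevel G a ℓ b = ℓ b := by
  classical
  exact Function.update_of_ne h _ _

theorem le_appendLevel (a : A) (ℓ : A → ℕ) (b : A) : ℓ b ≤ appendLevel G a ℓ b := by
  by_cases h : b = a
  · subst h
    exact (appendLevel_self b ℓ G.irrefl).le
  · rw [appendLevel_of_ne h]

theorem level_le_level_mul (u v : TraceMonoid G) (a : A) : level u a ≤ level (u * v) a := by
  induction v using mul_letter_induction with
  | one => simp
  | mul v b ih =>
    rw [← mul_assoc, level_mul_letter]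
    exact ih.trans (le_appendLevel _ _ _)

theorem count_le_level (u : TraceMonoid G) (a : A) : count a u ≤ level u a := by
  induction u using mul_letter_induction with
  | one => simp
  | mul u b ih =>
    rw [count_mul, level_mul_letter]
    by_cases h : b = a
    · subst h
      rw [count_letter_self]
      exact ih.trans_lt (appendLevel_self _ _ G.irrefl)
    · rw [count_letter_of_ne h, appendLevel_of_ne (Ne.symm h)]
      exact ih

/-- Distinct letters whose last occurrences have the same positive level are independent. -/
theorem adj_of_level_eq (u : TraceMonoid G) {a b : A} (hab : a ≠ b)
    (h : level u a = level u b) (h0 : level u a ≠ 0) : G.Adj a b := by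
  induction u using mul_letter_induction with
  | one => simp at h0
  | mul u c ih =>
    by_contra hG
    rw [level_mul_letter] at h h0
    by_cases hac : a = c
    · subst hac
      rw [appendLevel_of_ne hab.symm] at h
      exact absurd h (appendLevel_self _ _ hG).ne'
    · by_cases hbc : b = c
      · subst hbc
        rw [appendLevel_of_ne hab] at h
        exact absurd h (appendLevel_self _ _ fun h => hG h.symm).ne
      · rw [appendLevel_of_ne hac, appendLevel_of_ne hbc] at h
        rw [appendLevel_of_ne hac] at h0
        exact hG (ih h h0)

theorem finite_level_le (G : SimpleGraph A) (n : ℕ) :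
    {u : TraceMonoid G | ∀ a, level u a ≤ n}.Finite := by
  classical
  have hlen : ∀ u : TraceMonoid G, length u = ∑ a, count a u := by
    intro u
    induction u using letter_mul_induction with
    | one => simp
    | mul a u ih =>
      have : ∑ b, count b (letter G a) = 1 := by
        rw [Finset.sum_eq_single a (fun b _ h => count_letter_of_ne h.symm) (by simp),
          count_letter_self]
      simp [Finset.sum_add_distrib, ih, this]
  refine ((List.finite_length_le A (Fintype.card A * n)).image
    fun l => (l.map (letter G)).prod).subset ?_
  intro u hu
  obtain ⟨l, rfl⟩ := exists_list u
  refine ⟨l, ?_, rfl⟩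
  have hl : length (l.map (letter G)).prod = l.length := by
    clear hu
    induction l with
    | nil => simp
    | cons a l ih => simp [ih, add_comm]
  show l.length ≤ _
  rw [← hl, hlen]
  refine (Finset.sum_le_card_nsmul _ _ n fun a _ => (count_le_level _ a).trans (hu a)).trans ?_
  simp

/-- The traces with at most `n` levels. -/
noncomputable def levelSet (G : SimpleGraph A) (n : ℕ) : Finset (TraceMonoid G) :=
  (finite_level_le G n).toFinset

theorem mem_levelSet {n : ℕ} {u : TraceMonoid G} :
    u ∈ levelSet G n ↔ ∀ a, level u a ≤ n := by
  simp [levelSet]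

theorem mem_levelSet_of_mul {n : ℕ} {u v : TraceMonoid G} (h : u * v ∈ levelSet G n) :
    u ∈ levelSet G n :=
  mem_levelSet.2 fun a => (level_le_level_mul u v a).trans (mem_levelSet.1 h a)

theorem exists_mem_levelSet (u : TraceMonoid G) : ∃ n, ∀ m, n ≤ m → u ∈ levelSet G m :=
  ⟨∑ a, level u a, fun _ hm => mem_levelSet.2 fun a =>
    (Finset.single_le_sum (fun _ _ => Nat.zero_le _) (Finset.mem_univ a)).trans hm⟩

open Classical in
/-- The letters whose last occurrence is on level `n`; for `n = 0`, the letters that do not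
occur. -/
noncomputable def topLetters (n : ℕ) (u : TraceMonoid G) : Finset A :=
  Finset.univ.filter fun a => level u a = n

theorem mem_topLetters {n : ℕ} {u : TraceMonoid G} {a : A} :
    a ∈ topLetters n u ↔ level u a = n := by
  simp [topLetters]

theorem indep_topLetters {n : ℕ} (hn : n ≠ 0) (u : TraceMonoid G) :
    Indep G (topLetters n u) := by
  intro a ha b hb hab
  have ha' := mem_topLetters.1 (Finset.mem_coe.1 ha)
  have hb' := mem_topLetters.1 (Finset.mem_coe.1 hb)
  exact adj_of_level_eq u hab (ha'.trans hb'.symm) (ha' ▸ hn)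

open Classical in
/-- The letters of the highest level can be moved to the end. -/
theorem exists_eq_mul_topLetters {n : ℕ} (hn : n ≠ 0) {u : TraceMonoid G}
    (hu : u ∈ levelSet G n) : ∃ v, u = v * prodLetters G (topLetters n u) := by
  induction u using mul_letter_induction with
  | one =>
    have : topLetters n (1 : TraceMonoid G) = ∅ := by
      ext a
      simp [mem_topLetters, hn.symm]
    exact ⟨1, by simp [this]⟩
  | mul u a ih =>
    have hu' := mem_levelSet_of_mul hu
    obtain ⟨v, hv⟩ := ih hu'
    have hmem := mem_levelSet.1 hu a
    have hlt : ∀ b, ¬ G.Adj a b → level u b < level (u * letter G a) a := by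
      intro b hb
      rw [level_mul_letter]
      exact appendLevel_self a _ hb
    have hne : ∀ b, b ≠ a → level (u * letter G a) b = level u b := by
      intro b hb
      rw [level_mul_letter, appendLevel_of_ne hb]
    have hau : a ∉ topLetters n u := by
      rw [mem_topLetters]
      have := hlt a G.irrefl
      omega
    have hadj : ∀ b ∈ topLetters n u, G.Adj a b := by
      intro b hb
      rw [mem_topLetters] at hb
      by_contra hG
      have := hlt b hG
      omega
    have hind : Indep G (insert a (topLetters n u)) := by
      rw [Indep, Finset.coe_insert, SimpleGraph.isClique_insert]
      exact ⟨indep_topLetters hn u, fun b hb _ => hadj b hb⟩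
    by_cases htop : level (u * letter G a) a = n
    · have : topLetters n (u * letter G a) = insert a (topLetters n u) := by
        ext b
        rw [Finset.mem_insert, mem_topLetters, mem_topLetters]
        by_cases hb : b = a
        · simp [hb, htop]
        · simp [hb, hne b hb]
      refine ⟨v, ?_⟩
      rw [this, prodLetters_insert_right hau hind, ← mul_assoc, ← hv]
    · have : topLetters n (u * letter G a) = topLetters n u := by
        ext b
        rw [mem_topLetters, mem_topLetters]
        by_cases hb : b = a
        · subst hb
          have := hlt b G.irrefl
          constructor <;> intro h <;> omega
        · rw [hne b hb]
      refine ⟨v * letter G a, ?_⟩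
      rw [this, mul_assoc, ← prodLetters_insert hau hind, prodLetters_insert_right hau hind,
        ← mul_assoc, ← hv]

open Classical in
theorem mul_prodLetters_mem_levelSet {n : ℕ} {u : TraceMonoid G} (hu : u ∈ levelSet G n)
    {S : Finset A} (hS : Indep G S) :
    u * prodLetters G S ∈ levelSet G n ↔ ∀ s ∈ S, ∀ c ∈ topLetters n u, G.Adj s c := by
  have hlevel : ∀ a, level (u * prodLetters G S) a =
      if a ∈ S then (Finset.univ.filter fun b => ¬ G.Adj a b).sup (level u) + 1
      else level u a := by
    induction S using Finset.induction_on with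
    | empty => simp
    | insert b S hb ih =>
      intro a
      have ih := ih (hS.mono (Finset.subset_insert _ _))
      rw [prodLetters_insert_right hb hS, ← mul_assoc, level_mul_letter]
      by_cases hab : a = b
      · subst hab
        rw [if_pos (Finset.mem_insert_self _ _), appendLevel, Function.update_self]
        congr 1
        refine Finset.sup_congr rfl fun c hc => ?_
        have hc' := (Finset.mem_filter.1 hc).2
        rw [ih c, if_neg]
        intro hcS
        refine hc' (hS (by simp) (by simp [hcS]) ?_)
        rintro rfl
        exact hb hcS
      · rw [appendLevel_of_ne hab, ih a]
        simp [hab]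
  rw [mem_levelSet]
  constructor
  · intro h s hs c hc
    by_contra hG
    have h1 := h s
    rw [hlevel, if_pos hs] at h1
    have h2 : level u c ≤ (Finset.univ.filter fun b => ¬ G.Adj s b).sup (level u) :=
      Finset.le_sup (f := level u) (by simp [hG])
    rw [mem_topLetters] at hc
    omega
  · intro h a
    rw [hlevel]
    split_ifs with ha
    · rw [Nat.succ_le_iff]
      have hn : 0 < n := by
        rw [Nat.pos_iff_ne_zero]
        rintro rfl
        exact G.irrefl (h a ha a (mem_topLetters.2 (Nat.le_zero.1 (mem_levelSet.1 hu a))))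
      rw [Finset.sup_lt_iff hn]
      intro b hb
      refine lt_of_le_of_ne (mem_levelSet.1 hu b) fun hb' => ?_
      exact (Finset.mem_filter.1 hb).2 (h a ha b (mem_topLetters.2 hb'))
    · exact mem_levelSet.1 hu a

end Level

/-! ### Finite approximations of the Bernoulli measure -/

section Weight

variable {A : Type*} {G : SimpleGraph A} [Fintype A] {f : TraceMonoid G → ℝ}

open Classical in
/-- The weight of the trace `u` in the `n`-th approximation: the probability that the part of an
infinite trace on its first `n` levels is `u`. -/
noncomputable def weight (f : TraceMonoid G → ℝ) (n : ℕ) (u : TraceMonoid G) : ℝ :=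
  ∑ S : Finset A with Indep G S ∧ u * prodLetters G S ∈ levelSet G n,
    (-1 : ℝ) ^ S.card * f (u * prodLetters G S)

open Classical in
theorem weight_eq (hf : IsValuation f) {n : ℕ} (hn : n ≠ 0) {u v : TraceMonoid G}
    (hu : u ∈ levelSet G n) (hv : u = v * prodLetters G (topLetters n u)) :
    weight f n u =
      f v * mobiusTransform (fun c : Clique G => f c.1) (cliqueOf (indep_topLetters hn u)) := by
  rw [mobiusTransform_cliqueOf, Finset.mul_sum, weight]
  set C := topLetters n u
  have hmem : ∀ S : Finset A, S ∈ (Finset.univ.filter fun S : Finset A =>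
      Indep G S ∧ u * prodLetters G S ∈ levelSet G n) → Disjoint C S ∧ Indep G (C ∪ S) := by
    intro S hS
    simp only [Finset.mem_filter, Finset.mem_univ, true_and] at hS
    have h := (mul_prodLetters_mem_levelSet hu hS.1).1 hS.2
    constructor
    · rw [Finset.disjoint_left]
      exact fun a ha ha' => G.irrefl (h a ha' a ha)
    · rw [Indep, Finset.coe_union]
      intro a ha b hb hab
      rcases ha with ha | ha <;> rcases hb with hb | hb
      · exact indep_topLetters hn u ha hb hab
      · exact (h b hb a ha).symm
      · exact h a ha b hb
      · exact hS.1 ha hb hab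
  refine Finset.sum_bij' (fun S _ => C ∪ S) (fun S _ => S \ C) ?_ ?_ ?_ ?_ ?_
  · intro S hS
    simp only [Finset.mem_filter, Finset.mem_univ, true_and]
    exact ⟨(hmem S hS).2, Finset.subset_union_left⟩
  · intro S hS
    simp only [Finset.mem_filter, Finset.mem_univ, true_and] at hS ⊢
    have hS' := hS.1.mono (Finset.sdiff_subset (s := S) (t := C))
    refine ⟨hS', (mul_prodLetters_mem_levelSet hu hS').2 fun s hs c hc => ?_⟩
    rw [Finset.mem_sdiff] at hs
    refine hS.1 hs.1 (hS.2 hc) ?_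
    rintro rfl
    exact hs.2 hc
  · intro S hS
    exact Finset.union_sdiff_cancel_left (hmem S hS).1
  · intro S hS
    exact Finset.union_sdiff_of_subset (Finset.mem_filter.1 hS).2.2
  · intro S hS
    obtain ⟨h1, h2⟩ := hmem S hS
    rw [Finset.card_union_of_disjoint h1, Nat.add_sub_cancel_left]
    have : u * prodLetters G S = v * prodLetters G (C ∪ S) := by
      rw [prodLetters_union h1 h2, ← mul_assoc, ← hv]
    rw [this, hf.mul]
    ring

theorem weight_nonneg (hf : IsMobiusValuation f) {n : ℕ} (hn : n ≠ 0) {u : TraceMonoid G}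
    (hu : u ∈ levelSet G n) : 0 ≤ weight f n u := by
  obtain ⟨v, hv⟩ := exists_eq_mul_topLetters hn hu
  rw [weight_eq hf.toIsValuation hn hu hv]
  refine mul_nonneg (hf.pos v).le ?_
  by_cases h : cliqueOf (indep_topLetters hn u) = emptyClique G
  · rw [h, hf.mobius_empty]
  · exact (hf.mobius_pos _ h).le

/-- The approximation of index `n` does not charge the traces with less than `n` levels. -/
theorem weight_eq_zero (hf : IsMobiusValuation f) {n : ℕ} {u : TraceMonoid G}
    (hu : u ∈ levelSet G n) : weight f (n + 1) u = 0 := by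
  have hn : n + 1 ≠ 0 := n.succ_ne_zero
  have hu' : u ∈ levelSet G (n + 1) :=
    mem_levelSet.2 fun a => (mem_levelSet.1 hu a).trans n.le_succ
  have htop : topLetters (n + 1) u = ∅ := by
    ext a
    have := mem_levelSet.1 hu a
    simp only [mem_topLetters, Finset.notMem_empty, iff_false]
    omega
  obtain ⟨v, hv⟩ := exists_eq_mul_topLetters hn hu'
  have h : cliqueOf (indep_topLetters hn u) = emptyClique G :=
    not_not.1 (mt (cliqueOf_ne_emptyClique _).1 (not_not.2 htop))
  rw [weight_eq hf.toIsValuation hn hu' hv, h, hf.mobius_empty, mul_zero]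

open Classical in
/-- The alternating sum over the cliques that divide `y` on the right, with a quotient above `x`. -/
theorem sum_right_divisors (x y : TraceMonoid G) :
    ∑ S : Finset A with Indep G S ∧ ∃ u, x ∣ u ∧ u * prodLetters G S = y,
      (-1 : ℝ) ^ S.card = if y = x then 1 else 0 := by
  by_cases hxy : x ∣ y
  · obtain ⟨z, rfl⟩ := hxy
    -- by left cancellation, these are the cliques below the reversal of `z`
    let T : Finset A := Finset.univ.filter fun a => letter G a ∣ reverse z
    have hT : Indep G T := by
      intro a ha b hb hab
      exact adj_of_letter_dvd hab (Finset.mem_filter.1 ha).2 (Finset.mem_filter.1 hb).2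
    have hTz : x * z = x ↔ ∅ = T := by
      constructor
      · intro h
        have hz : z = 1 := mul_left_cancel (a := x) (by rw [h, mul_one])
        symm
        refine Finset.filter_false_of_mem fun a _ ha => ?_
        rw [hz, reverse_one] at ha
        exact not_letter_dvd_one a ha
      · intro h
        rcases eq_one_or_exists_letter_dvd (reverse z) with h1 | ⟨a, ha⟩
        · rw [← reverse_reverse z, h1, reverse_one, mul_one]
        · exact absurd (h ▸ Finset.mem_filter.2 ⟨Finset.mem_univ a, ha⟩ : a ∈ (∅ : Finset A))
            (Finset.notMem_empty a)
    rw [if_congr hTz rfl rfl, ← sum_neg_one_pow_card_sub ∅ T]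
    refine Finset.sum_congr ?_ (by simp)
    ext S
    simp only [Finset.mem_filter, Finset.mem_univ, true_and, Finset.empty_subset]
    constructor
    · rintro ⟨hS, u, ⟨w, rfl⟩, hu⟩ a ha
      rw [mul_assoc] at hu
      refine Finset.mem_filter.2 ⟨Finset.mem_univ a, ?_⟩
      rw [← mul_left_cancel hu, reverse_mul, reverse_prodLetters hS]
      exact ((letter_dvd_prodLetters hS).2 ha).trans (dvd_mul_right _ _)
    · intro hS
      have hS' := hT.mono hS
      refine ⟨hS', ?_⟩
      obtain ⟨w, hw⟩ := (prodLetters_dvd_iff hS').2 fun a ha => (Finset.mem_filter.1 (hS ha)).2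
      refine ⟨x * reverse w, dvd_mul_right _ _, ?_⟩
      rw [← reverse_reverse z, hw, reverse_mul, reverse_prodLetters hS', mul_assoc]
  · rw [if_neg, Finset.filter_false_of_mem, Finset.sum_empty]
    · rintro S - ⟨_, u, hxu, rfl⟩
      exact hxy (hxu.trans (dvd_mul_right _ _))
    · rintro rfl
      exact hxy dvd_rfl

open Classical in
/-- Möbius inversion: the total weight of the traces above `x` is `f x`. -/
theorem sum_weight (f : TraceMonoid G → ℝ) {n : ℕ} {x : TraceMonoid G} (hx : x ∈ levelSet G n) :
    ∑ u ∈ levelSet G n with x ∣ u, weight f n u = f x := by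
  calc ∑ u ∈ levelSet G n with x ∣ u, weight f n u
      = ∑ S : Finset A with Indep G S, ∑ u ∈ levelSet G n with
          x ∣ u ∧ u * prodLetters G S ∈ levelSet G n,
          (-1 : ℝ) ^ S.card * f (u * prodLetters G S) := by
        simp only [weight]
        refine Finset.sum_comm' fun u S => ?_
        simp only [Finset.mem_filter, Finset.mem_univ, true_and]
        tauto
    _ = ∑ S : Finset A with Indep G S, ∑ y ∈ levelSet G n with
          ∃ u, x ∣ u ∧ u * prodLetters G S = y, (-1 : ℝ) ^ S.card * f y := by
        refine Finset.sum_congr rfl fun S _ => ?_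
        refine Finset.sum_bij (fun u _ => u * prodLetters G S) ?_ ?_ ?_ ?_
        · intro u hu
          simp only [Finset.mem_filter] at hu ⊢
          exact ⟨hu.2.2, u, hu.2.1, rfl⟩
        · intro u _ v _ h
          exact mul_right_cancel h
        · intro y hy
          obtain ⟨hy, u, hu, rfl⟩ := Finset.mem_filter.1 hy
          exact ⟨u, Finset.mem_filter.2 ⟨mem_levelSet_of_mul hy, hu, hy⟩, rfl⟩
        · intro u _
          rfl
    _ = ∑ y ∈ levelSet G n, ∑ S : Finset A with
          Indep G S ∧ ∃ u, x ∣ u ∧ u * prodLetters G S = y, (-1 : ℝ) ^ S.card * f y := by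
        refine Finset.sum_comm' fun S y => ?_
        simp only [Finset.mem_filter, Finset.mem_univ, true_and]
        tauto
    _ = f x := by
        simp only [← Finset.sum_mul, sum_right_divisors, ite_mul, one_mul, zero_mul]
        rw [Finset.sum_ite_eq' (levelSet G n) x, if_pos hx]

end Weight

/-! ### Existence and uniqueness of the Bernoulli measure -/

section Existence

open MeasureTheory Filter Topology

variable {A : Type*} {G : SimpleGraph A}

instance [Finite A] : Countable (TraceMonoid G) := by
  have : Countable (FreeMonoid A) := inferInstanceAs (Countable (List A))
  exact (PresentedMonoid.surjective_mk (rels := TraceRel G)).countable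

open Classical in
/-- The set of the divisors of a trace, as a point of the compact space `TraceMonoid G → Bool`. -/
noncomputable def divisors (u : TraceMonoid G) : TraceMonoid G → Bool := fun v => decide (v ∣ u)

theorem divisors_apply {u v : TraceMonoid G} : divisors u v = true ↔ v ∣ u := by
  simp [divisors]

theorem isClopen_eq_true (u : TraceMonoid G) :
    IsClopen {D : TraceMonoid G → Bool | D u = true} :=
  (isClopen_discrete {true}).preimage (continuous_apply u)

open Classical in
/-- The `n`-th approximation of the Bernoulli measure, on sets of traces. It is carried by the sets
of divisors of the traces with at most `n + 1` levels. -/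
noncomputable def approx [Fintype A] (f : TraceMonoid G → ℝ) (n : ℕ) :
    Measure (TraceMonoid G → Bool) :=
  ∑ u ∈ levelSet G (n + 1), ENNReal.ofReal (weight f (n + 1) u) • Measure.dirac (divisors u)

open Classical in
theorem approx_apply [Fintype A] {f : TraceMonoid G → ℝ} (hf : IsMobiusValuation f) (n : ℕ)
    {B : Set (TraceMonoid G → Bool)} (hB : MeasurableSet B) :
    approx f n B =
      ENNReal.ofReal (∑ u ∈ levelSet G (n + 1) with divisors u ∈ B, weight f (n + 1) u) := by
  rw [approx, Measure.finsetSum_apply, ENNReal.ofReal_sum_of_nonneg, Finset.sum_filter]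
  · refine Finset.sum_congr rfl fun u _ => ?_
    rw [Measure.smul_apply, Measure.dirac_apply' _ hB, Set.indicator_apply]
    simp
  · intro u hu
    exact weight_nonneg hf n.succ_ne_zero (Finset.mem_filter.1 hu).1

theorem approx_eq_true [Fintype A] {f : TraceMonoid G → ℝ} (hf : IsMobiusValuation f) {n : ℕ}
    {x : TraceMonoid G} (hx : x ∈ levelSet G (n + 1)) :
    approx f n {D | D x = true} = ENNReal.ofReal (f x) := by
  classical
  rw [approx_apply hf n (isClopen_eq_true x).isOpen.measurableSet, ← sum_weight f hx]
  simp only [Set.mem_ofPred_eq, divisors_apply]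

theorem IsValuation.map_one {f : TraceMonoid G → ℝ} (hf : IsValuation f) : f 1 = 1 := by
  have h := hf.mul 1 1
  rw [mul_one] at h
  exact (mul_eq_left₀ (hf.pos 1).ne').1 h.symm

theorem approx_eq_one [Fintype A] {f : TraceMonoid G → ℝ} (hf : IsMobiusValuation f) (n : ℕ)
    {B : Set (TraceMonoid G → Bool)} (hB : MeasurableSet B) (h : ∀ u, divisors u ∈ B) :
    approx f n B = 1 := by
  classical
  have h1 : (1 : TraceMonoid G) ∈ levelSet G (n + 1) := mem_levelSet.2 (by simp)
  have h2 := sum_weight f h1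
  rw [hf.toIsValuation.map_one] at h2
  rw [approx_apply hf n hB, ← ENNReal.ofReal_one, ← h2]
  simp [h]

theorem isClopen_maximal [Finite A] (u : TraceMonoid G) :
    IsClopen {D : TraceMonoid G → Bool |
      D u = true ∧ ∀ a, ¬ D (u * letter G a) = true} := by
  have h : {D : TraceMonoid G → Bool | D u = true ∧ ∀ a, ¬ D (u * letter G a) = true} =
      {D | D u = true} ∩ ⋂ a, {D | D (u * letter G a) = true}ᶜ := by
    ext D
    simp
  rw [h]
  exact (isClopen_eq_true u).inter (isClopen_iInter_of_finite fun a => (isClopen_eq_true _).compl)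

theorem approx_eq_zero [Fintype A] {f : TraceMonoid G → ℝ} (hf : IsMobiusValuation f) (n : ℕ)
    {B : Set (TraceMonoid G → Bool)} (hB : MeasurableSet B)
    (h : ∀ u, divisors u ∈ B → weight f (n + 1) u = 0) : approx f n B = 0 := by
  classical
  rw [approx_apply hf n hB, Finset.sum_eq_zero, ENNReal.ofReal_zero]
  exact fun u hu => h u (Finset.mem_filter.1 hu).2

theorem approx_maximal [Fintype A] {f : TraceMonoid G → ℝ} (hf : IsMobiusValuation f) {n : ℕ}
    {u : TraceMonoid G} (hu : u ∈ levelSet G n) :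
    approx f n {D | D u = true ∧ ∀ a, ¬ D (u * letter G a) = true} = 0 := by
  refine approx_eq_zero hf n (isClopen_maximal u).isOpen.measurableSet ?_
  rintro v ⟨h1, h2⟩
  obtain ⟨w, rfl⟩ := divisors_apply.1 h1
  -- no letter can be appended to `u` below `u * w`, so that `w` is empty
  have hw : w = 1 := by
    rcases eq_one_or_exists_letter_dvd w with h | ⟨a, ha⟩
    · exact h
    · exact absurd (divisors_apply.2 (mul_dvd_mul_left u ha)) (h2 a)
  rw [hw, mul_one]
  exact weight_eq_zero hf hu

/-- A weak limit of the approximations, along a non-principal ultrafilter. -/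
theorem exists_limit_measure [Fintype A] {f : TraceMonoid G → ℝ} (hf : IsMobiusValuation f) :
    ∃ μ : Measure (TraceMonoid G → Bool), IsProbabilityMeasure μ ∧
      ∀ (B : Set (TraceMonoid G → Bool)) (c : ENNReal), IsClopen B →
        (∀ᶠ n in atTop, approx f n B = c) → μ B = c := by
  have hprob : ∀ n, IsProbabilityMeasure (approx f n) := fun n =>
    ⟨approx_eq_one hf n MeasurableSet.univ fun _ => Set.mem_univ _⟩
  let ν : ℕ → ProbabilityMeasure (TraceMonoid G → Bool) := fun n => ⟨approx f n, hprob n⟩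
  obtain ⟨μ, -, hμ⟩ := isCompact_univ.ultrafilter_le_nhds ((hyperfilter ℕ).map ν) (by simp)
  have hμ' : Tendsto ν (hyperfilter ℕ : Filter ℕ) (𝓝 μ) := hμ
  refine ⟨μ, inferInstance, fun B c hB hc => ?_⟩
  have h1 := ProbabilityMeasure.tendsto_measure_of_null_frontier_of_tendsto' hμ'
    (show (μ : Measure _) (frontier B) = 0 by rw [hB.frontier_eq, measure_empty])
  refine tendsto_nhds_unique h1 (tendsto_const_nhds.congr' ?_)
  filter_upwards [Nat.hyperfilter_le_atTop hc] with n hn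
  exact hn.symm

/-- The set of the traces below an infinite trace, characterized as a downward closed and directed
set without a largest element. -/
structure IsInfiniteIdeal (D : TraceMonoid G → Bool) : Prop where
  one : D 1 = true
  lower : ∀ u v, u ∣ v → D v = true → D u = true
  directed : ∀ u v, D u = true → D v = true → ∃ z, D z = true ∧ u ∣ z ∧ v ∣ z
  unbounded : ∀ u, D u = true → ∃ a, D (u * letter G a) = true

theorem IsInfiniteIdeal.exists_boundary [Finite A] {D : TraceMonoid G → Bool}
    (hD : IsInfiniteIdeal D) : ∃ ξ : Boundary G, ∀ u, ξ ∈ cylinder u ↔ D u = true := by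
  classical
  let I := {u : TraceMonoid G // D u = true}
  have : Encodable I := Encodable.ofCountable I
  have : Inhabited I := ⟨⟨1, hD.one⟩⟩
  have hdir : Directed (· ∣ ·) (fun u : I => u.1) := by
    intro u v
    obtain ⟨z, hz, h1, h2⟩ := hD.directed u.1 v.1 u.2 v.2
    exact ⟨⟨z, hz⟩, h1, h2⟩
  let s : NondecSeq G := ⟨fun k => (hdir.sequence _ k).1, fun k => hdir.sequence_mono_nat k⟩
  have hs : ∀ u, (∃ k, u ∣ s.seq k) ↔ D u = true := by
    intro u
    constructor
    · rintro ⟨k, hk⟩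
      exact hD.lower u _ hk (hdir.sequence _ k).2
    · intro hu
      exact ⟨_, hdir.rel_sequence ⟨u, hu⟩⟩
  refine ⟨⟨toAntisymmetrization (· ≤ ·) s, fun h => ?_⟩, fun u =>
    (toGeneralized_le_iff s u).trans (hs u)⟩
  obtain ⟨u, hu, hsu⟩ := (toAntisymmetrization_mem_range_iff s).1 h
  obtain ⟨a, ha⟩ := hD.unbounded u ((hs u).1 hu)
  obtain ⟨k, hk⟩ := (hs _).2 ha
  have h1 : letter G a ∣ 1 := mul_dvd_mul_iff.1 (by simpa using hk.trans (hsu k))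
  exact not_letter_dvd_one a h1

theorem ae_isInfiniteIdeal [Fintype A] {f : TraceMonoid G → ℝ} (hf : IsMobiusValuation f)
    {μ : Measure (TraceMonoid G → Bool)} [IsProbabilityMeasure μ]
    (hμ : ∀ (B : Set (TraceMonoid G → Bool)) (c : ENNReal), IsClopen B →
        (∀ᶠ n in atTop, approx f n B = c) → μ B = c) :
    ∀ᵐ D ∂μ, IsInfiniteIdeal D := by
  -- a clopen property of all the sets of divisors passes to the limit
  have key : ∀ B : Set (TraceMonoid G → Bool), IsClopen B → (∀ u, divisors u ∈ B) →
      ∀ᵐ D ∂μ, D ∈ B := by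
    intro B hB h
    have h1 : μ B = 1 :=
      hμ B 1 hB (Eventually.of_forall fun n => approx_eq_one hf n hB.isOpen.measurableSet h)
    exact (mem_ae_iff_prob_eq_one hB.isOpen.measurableSet).2 h1
  have himp : ∀ u v : TraceMonoid G,
      IsClopen {D : TraceMonoid G → Bool | D u = true → D v = true} := by
    intro u v
    have : {D : TraceMonoid G → Bool | D u = true → D v = true} =
        {D | D u = true}ᶜ ∪ {D | D v = true} := by
      ext D
      exact imp_iff_not_or
    rw [this]
    exact (isClopen_eq_true u).compl.union (isClopen_eq_true v)
  have h1 : ∀ᵐ D ∂μ, D 1 = true :=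
    key _ (isClopen_eq_true 1) fun u => divisors_apply.2 (one_dvd u)
  have h2 : ∀ᵐ D ∂μ, ∀ u v : TraceMonoid G, u ∣ v → D v = true → D u = true := by
    rw [ae_all_iff]
    intro u
    rw [ae_all_iff]
    intro v
    by_cases huv : u ∣ v
    · filter_upwards [key _ (himp v u) fun w hw =>
        divisors_apply.2 (huv.trans (divisors_apply.1 hw))] with D hD _
      exact hD
    · exact Eventually.of_forall fun D h => absurd h huv
  have h3 : ∀ᵐ D ∂μ, ∀ u v : TraceMonoid G, D u = true → D v = true →
      ∃ z, D z = true ∧ u ∣ z ∧ v ∣ z := by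
    rw [ae_all_iff]
    intro u
    rw [ae_all_iff]
    intro v
    by_cases huv : ∃ x, u ∣ x ∧ v ∣ x
    · -- the least common multiple turns directedness into a clopen condition
      obtain ⟨x, hu, hv⟩ := huv
      obtain ⟨z, hz1, hz2, hz⟩ := exists_lcm hu hv
      have hB : IsClopen {D : TraceMonoid G → Bool |
          D u = true ∧ D v = true → D z = true} := by
        have : {D : TraceMonoid G → Bool | D u = true ∧ D v = true → D z = true} =
            ({D | D u = true} ∩ {D | D v = true})ᶜ ∪ {D | D z = true} := by
          ext D
          exact imp_iff_not_or
        rw [this]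
        exact ((isClopen_eq_true u).inter (isClopen_eq_true v)).compl.union (isClopen_eq_true z)
      filter_upwards [key _ hB fun w hw => divisors_apply.2
        (hz w (divisors_apply.1 hw.1) (divisors_apply.1 hw.2))] with D hD hDu hDv
      exact ⟨z, hD ⟨hDu, hDv⟩, hz1, hz2⟩
    · filter_upwards [key _ ((isClopen_eq_true u).inter (isClopen_eq_true v)).compl
        fun w hw => huv ⟨w, divisors_apply.1 hw.1, divisors_apply.1 hw.2⟩] with D hD hDu hDv
      exact absurd ⟨hDu, hDv⟩ hD
  have h4 : ∀ᵐ D ∂μ, ∀ u : TraceMonoid G, D u = true → ∃ a, D (u * letter G a) = true := by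
    rw [ae_all_iff]
    intro u
    have h : μ {D | D u = true ∧ ∀ a, ¬ D (u * letter G a) = true} = 0 := by
      refine hμ _ 0 (isClopen_maximal u) ?_
      obtain ⟨n, hn⟩ := exists_mem_levelSet u
      filter_upwards [eventually_ge_atTop n] with m hm
      exact approx_maximal hf (hn m hm)
    filter_upwards [measure_eq_zero_iff_ae_notMem.1 h] with D hD hDu
    by_contra! hna
    exact hD ⟨hDu, fun a => hna a⟩
  filter_upwards [h1, h2, h3, h4] with D h1 h2 h3 h4
  exact ⟨h1, h2, h3, h4⟩

theorem exists_measure_cylinder_eq [Fintype A] {f : TraceMonoid G → ℝ}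
    (hf : IsMobiusValuation f) :
    ∃ P : Measure (Boundary G), ∀ u, P (cylinder u) = ENNReal.ofReal (f u) := by
  classical
  obtain ⟨μ, hprob, hμ⟩ := exists_limit_measure hf
  have hae := ae_isInfiniteIdeal hf hμ
  obtain ⟨N, hN, hNm, hN0⟩ := exists_measurable_superset_of_null (ae_iff.1 hae)
  have hex : ∀ D, D ∉ N → ∃ ξ : Boundary G, ∀ u, ξ ∈ cylinder u ↔ D u = true := by
    intro D hD
    exact IsInfiniteIdeal.exists_boundary (not_not.1 fun h => hD (hN h))
  obtain ⟨D₀, hD₀⟩ := hae.exists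
  obtain ⟨ξ₀, -⟩ := hD₀.exists_boundary
  let φ : (TraceMonoid G → Bool) → Boundary G := fun D =>
    if h : D ∈ N then ξ₀ else (hex D h).choose
  have hφ : ∀ D, D ∉ N → ∀ u, φ D ∈ cylinder u ↔ D u = true := by
    intro D hD u
    simp only [φ, dif_neg hD]
    exact (hex D hD).choose_spec u
  have hmeas : Measurable φ := by
    refine measurable_generateFrom ?_
    rintro _ ⟨u, rfl⟩
    have : φ ⁻¹' cylinder u =
        (N ∩ {_D | ξ₀ ∈ cylinder u}) ∪ (Nᶜ ∩ {D | D u = true}) := by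
      ext D
      by_cases hD : D ∈ N
      · simp [hD, φ]
      · simp [hD, hφ D hD u]
    rw [this]
    exact (hNm.inter (MeasurableSet.const _)).union
      (hNm.compl.inter (isClopen_eq_true u).isOpen.measurableSet)
  refine ⟨μ.map φ, fun u => ?_⟩
  rw [Measure.map_apply hmeas (measurableSet_cylinder u)]
  have : μ (φ ⁻¹' cylinder u) = μ {D | D u = true} := by
    refine measure_congr ?_
    filter_upwards [measure_eq_zero_iff_ae_notMem.1 hN0] with D hD
    exact propext (hφ D hD u)
  rw [this]
  refine hμ _ _ (isClopen_eq_true u) ?_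
  obtain ⟨n, hn⟩ := exists_mem_levelSet u
  filter_upwards [eventually_ge_atTop n] with m hm
  exact approx_eq_true hf (hn _ (hm.trans m.le_succ))

theorem measure_ext_of_cylinder {P Q : Measure (Boundary G)} [IsFiniteMeasure P]
    (h : ∀ u, P (cylinder u) = Q (cylinder u)) : P = Q := by
  refine ext_of_generate_finite _ rfl isPiSystem_cylinder ?_ ?_
  · rintro _ ⟨u, rfl⟩
    exact h u
  · rw [← cylinder_one, h]

theorem IsMobiusValuation.existsUnique_isBernoulli [Finite A] {f : TraceMonoid G → ℝ}
    (hf : IsMobiusValuation f) :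
    ∃! P : Measure (Boundary G), IsBernoulli P ∧ ∀ u : TraceMonoid G, P.real (cylinder u) = f u := by
  have := Fintype.ofFinite A
  obtain ⟨P, hP⟩ := exists_measure_cylinder_eq hf
  refine ⟨P, ⟨⟨⟨?_⟩, fun u => ?_, fun u v => ?_⟩, fun u => ?_⟩, ?_⟩
  · rw [← cylinder_one, hP, hf.toIsValuation.map_one, ENNReal.ofReal_one]
  · rw [hP]
    exact ENNReal.ofReal_pos.2 (hf.pos u)
  · rw [hP, hP, hP, hf.mul, ENNReal.ofReal_mul (hf.pos u).le]
  · rw [measureReal_def, hP, ENNReal.toReal_ofReal (hf.pos u).le]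
  · rintro Q ⟨hQ, hQf⟩
    have := hQ.isProbabilityMeasure
    refine measure_ext_of_cylinder fun u => ?_
    rw [hP, ← hQf u, ofReal_measureReal]

end Existence

end TraceMonoid

theorem theorem1 {A : Type*} [Finite A] (G : SimpleGraph A)
    (hG : TraceMonoid.IsIrreducible G) :
    (∀ P : MeasureTheory.Measure (TraceMonoid.Boundary G), TraceMonoid.IsBernoulli P →
      TraceMonoid.IsMobiusValuation
        (fun u : TraceMonoid G => P.real (TraceMonoid.cylinder u))) ∧
    (∀ f : TraceMonoid G → ℝ, TraceMonoid.IsMobiusValuation f →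
      ∃! P : MeasureTheory.Measure (TraceMonoid.Boundary G),
        TraceMonoid.IsBernoulli P ∧
          ∀ u : TraceMonoid G, P.real (TraceMonoid.cylinder u) = f u) :=
  ⟨fun _ hP => hP.isMobiusValuation hG, fun _ hf => hf.existsUnique_isBernoulli⟩
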